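/- Let $n$ be a natural number, let $G$ be an abelian subgroup of $GL(n,\mathbb{C})$, acting linearly on $\mathbb{C}^n$, and let $u\in\mathbb{C}^n$. Write $G(u)=\{Au : A\in G\}$ for the orbit of $u$, $E(u)$ for the complex vector subspace of $\mathbb{C}^n$ generated by $G(u)$, and $r(u)=\dim_{\mathbb{C}}E(u)$. Call an orbit $\gamma$ regular with order $m$ if every $v\in\gamma$ has an open neighbourhood $O$ in $\mathbb{C}^n$ such that $\overline{\gamma}\cap O$ is a manifold of dimension $m$ over $\mathbb{R}$, that is, an embedded $m$-dimensional $C^k$ submanifold of $\mathbb{C}^n=\mathbb{R}^{2n}$; here $k$ is any fixed differentiability class, $k\in\{1,2,\dots,\infty\}$ or $k=\omega$ (real-analytic). Then the closure $\overline{G(u)}$ is a complex vector subspace of $\mathbb{C}^n$ if and only if $G(u)$ is regular with order $2r(u)$. -/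

import Mathlib

open Matrix

/-- `S` is an embedded `C^k` submanifold, of dimension `m` over `ℝ`, of the real normed space `F`:
around each of its points some `C^k` diffeomorphism `φ` between open subsets of `F` carries `S` to
an `m`-dimensional real linear subspace `L`. -/
def IsEmbeddedSubmanifold {F : Type*} [NormedAddCommGroup F] [NormedSpace ℝ F]
    (k : WithTop ℕ∞) (m : ℕ) (S : Set F) : Prop :=
  ∀ p ∈ S, ∃ (φ : OpenPartialHomeomorph F F) (L : Submodule ℝ F),
    p ∈ φ.source ∧
    ContDiffOn ℝ k φ φ.source ∧
    ContDiffOn ℝ k φ.symm φ.target ∧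
    Module.Finite ℝ L ∧ Module.finrank ℝ L = m ∧
    ∀ x ∈ φ.source, x ∈ S ↔ φ x ∈ L

/-- The orbit `G(u) = {A u : A ∈ G}` of `u ∈ ℂⁿ` under the linear action of `G ≤ GL(n, ℂ)`. -/
def linOrbit {n : ℕ} (G : Subgroup (GL (Fin n) ℂ)) (u : Fin n → ℂ) : Set (Fin n → ℂ) :=
  {v | ∃ A ∈ G, v = (A : Matrix (Fin n) (Fin n) ℂ) *ᵥ u}

/-- `E(u)`, the complex vector subspace of `ℂⁿ` generated by the orbit `G(u)`. -/
def orbitSpan {n : ℕ} (G : Subgroup (GL (Fin n) ℂ)) (u : Fin n → ℂ) :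
    Submodule ℂ (Fin n → ℂ) :=
  Submodule.span ℂ (linOrbit G u)

/-- `r(u) = dim_ℂ E(u)`. -/
noncomputable def orbitRank {n : ℕ} (G : Subgroup (GL (Fin n) ℂ)) (u : Fin n → ℂ) : ℕ :=
  Module.finrank ℂ (orbitSpan G u)

/-- A subset `γ` of `ℂⁿ` (an orbit, in practice) is regular with order `m`: every `v ∈ γ` lies in an
open set `O` such that `closure γ ∩ O` is a manifold of dimension `m` over `ℝ`, that is, an embedded
`C^k` submanifold of `ℂⁿ = ℝ²ⁿ`. -/
def IsRegularOfOrder {n : ℕ} (k : WithTop ℕ∞) (m : ℕ) (γ : Set (Fin n → ℂ)) : Prop :=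
  ∀ v ∈ γ, ∃ O : Set (Fin n → ℂ), IsOpen O ∧ v ∈ O ∧ IsEmbeddedSubmanifold k m (closure γ ∩ O)

/-! If the closure is a subspace, it contains the span of the orbit, so it equals `E(u)`.
Conversely, regularity at `u` makes the closure a neighbourhood of `u` in `E(u)`, by equality of
dimensions and the inverse function theorem. As `G` is abelian, any `w` in `E(u)` is `a u` with `a`
commuting with `G`. Along the complex line of matrices from `1` to `a`, the parameters sending `u`
into the closure form a closed set, which is also open among those with invertible matrix. The
latter omit finitely many points of `ℂ`, hence are connected and dense, so `w` lies in the closure.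
-/

open Topology in
/-- A submanifold contained in a linear subspace of the same dimension is open in that subspace. -/
theorem IsEmbeddedSubmanifold.mem_nhdsWithin_of_subset {F : Type*} [NormedAddCommGroup F]
    [NormedSpace ℝ F] [FiniteDimensional ℝ F] {k : WithTop ℕ∞} (hk : 1 ≤ k) {m : ℕ} {S : Set F}
    (hS : IsEmbeddedSubmanifold k m S) {E : Submodule ℝ F} (hSE : S ⊆ E)
    (hE : Module.finrank ℝ E = m) {p : F} (hp : p ∈ S) : S ∈ 𝓝[(E : Set F)] p := by
  obtain ⟨φ, L, hps, hφ, hψ, -, hL, hiff⟩ := hS p hp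
  have hk0 : k ≠ 0 := (zero_lt_one.trans_le hk).ne'
  obtain ⟨P, hP⟩ := E.subtype.exists_leftInverse_of_injective E.ker_subtype
  have hPE : ∀ x (hx : x ∈ E), P x = ⟨x, hx⟩ := fun x hx => LinearMap.congr_fun hP ⟨x, hx⟩
  let Pc : F →L[ℝ] E := LinearMap.toContinuousLinearMap P
  have hyL : φ p ∈ L := (hiff p hps).1 hp
  let y : L := ⟨φ p, hyL⟩
  have hyt : (y : F) ∈ φ.target := φ.map_source hps
  -- Near `y`, the projection `Pc` fixes `φ.symm z`, so `f` is the local parametrization of `S`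
  -- viewed as a map into `E`.
  let f : L → E := fun z => Pc (φ.symm z)
  have hψS : ∀ z : L, (z : F) ∈ φ.target → φ.symm z ∈ S := fun z hz => by
    rw [hiff _ (φ.map_target hz), φ.right_inv hz]
    exact z.2
  have hf : ∀ z : L, (z : F) ∈ φ.target → (f z : F) = φ.symm z := fun z hz =>
    congrArg Subtype.val (hPE _ (hSE (hψS z hz)))
  have hsy : φ.symm (y : F) = p := φ.left_inv hps
  have hfy : (f y : F) = p := (hf y hyt).trans hsy
  have htn : ∀ᶠ z : L in 𝓝 y, (z : F) ∈ φ.target :=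
    continuous_subtype_val.continuousAt.eventually (φ.open_target.mem_nhds hyt)
  have hψd : HasStrictFDerivAt φ.symm (fderiv ℝ φ.symm (y : F)) (y : F) :=
    (hψ.contDiffAt (φ.open_target.mem_nhds hyt)).hasStrictFDerivAt hk0
  have hfd : HasStrictFDerivAt f (Pc ∘L (fderiv ℝ φ.symm (y : F)) ∘L L.subtypeL) y :=
    Pc.hasStrictFDerivAt.comp y (hψd.comp y L.subtypeL.hasStrictFDerivAt)
  set f' : L →L[ℝ] E := Pc ∘L (fderiv ℝ φ.symm (y : F)) ∘L L.subtypeL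
  have hφd : HasFDerivAt φ (fderiv ℝ φ p) (f y : F) := by
    rw [hfy]
    exact ((hφ.contDiffAt (φ.open_source.mem_nhds hps)).differentiableAt hk0).hasFDerivAt
  have hcomp : HasFDerivAt (fun z : L => φ (f z : F)) (fderiv ℝ φ p ∘L E.subtypeL ∘L f') y :=
    hφd.comp y (E.subtypeL.hasFDerivAt.comp y hfd.hasFDerivAt)
  have hincl : HasFDerivAt (fun z : L => φ (f z : F)) L.subtypeL y := by
    refine L.subtypeL.hasFDerivAt.congr_of_eventuallyEq ?_
    filter_upwards [htn] with z hz
    rw [hf z hz, φ.right_inv hz]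
    rfl
  have heq := hcomp.unique hincl
  -- Since `φ ∘ f` is the inclusion of `L` near `y`, `f'` has a left inverse on its image.
  have hinj : Function.Injective (f' : L →ₗ[ℝ] E) := by
    intro a b hab
    have hab' : f' a = f' b := hab
    have ha := DFunLike.congr_fun heq a
    have hb := DFunLike.congr_fun heq b
    simp only [ContinuousLinearMap.comp_apply] at ha hb
    rw [hab'] at ha
    exact Subtype.ext (ha.symm.trans hb)
  have hsurj : (f' : L →ₗ[ℝ] E).range = ⊤ := LinearMap.range_eq_top.2
    ((LinearMap.injective_iff_surjective_of_finrank_eq_finrank (hL.trans hE.symm)).1 hinj)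
  have hpE : p ∈ E := hSE hp
  have hfy' : f y = ⟨p, hpE⟩ := Subtype.ext hfy
  have hmap := hfd.map_nhds_eq_of_surj hsurj
  rw [hfy'] at hmap
  rw [mem_nhdsWithin_iff_exists_mem_nhds_inter]
  have hmem : (Subtype.val ⁻¹' S : Set E) ∈ 𝓝 (⟨p, hpE⟩ : E) := by
    rw [← hmap, Filter.mem_map]
    filter_upwards [htn] with z hz
    change (f z : F) ∈ S
    rw [hf z hz]
    exact hψS z hz
  obtain ⟨V, hV, hVS⟩ := mem_nhds_induced _ _ _ |>.1 hmem
  exact ⟨V, hV, fun x hx => hVS (show (⟨x, hx.2⟩ : E) ∈ Subtype.val ⁻¹' V from hx.1)⟩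

section

variable {n : ℕ} {G : Subgroup (GL (Fin n) ℂ)} {u : Fin n → ℂ}

theorem self_mem_linOrbit : u ∈ linOrbit G u := ⟨1, G.one_mem, by simp⟩

theorem closure_linOrbit_subset_orbitSpan : closure (linOrbit G u) ⊆ orbitSpan G u :=
  closure_minimal Submodule.subset_span (orbitSpan G u).closed_of_finiteDimensional

theorem finrank_real_orbitSpan :
    Module.finrank ℝ ((orbitSpan G u).restrictScalars ℝ) = 2 * orbitRank G u :=
  finrank_real_of_complex (orbitSpan G u)

theorem mulVec_mem_orbitSpan {A : GL (Fin n) ℂ} (hA : A ∈ G) {v : Fin n → ℂ}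
    (hv : v ∈ orbitSpan G u) : (A : Matrix (Fin n) (Fin n) ℂ) *ᵥ v ∈ orbitSpan G u := by
  have hle : orbitSpan G u ≤ (orbitSpan G u).comap (Matrix.mulVecLin (A : Matrix _ _ ℂ)) := by
    refine Submodule.span_le.2 ?_
    rintro _ ⟨B, hB, rfl⟩
    refine Submodule.subset_span ⟨A * B, G.mul_mem hA hB, ?_⟩
    simp [Matrix.mulVec_mulVec]
  exact hle hv

/-- Every vector of `E(u)` is the image of `u` under a matrix commuting with `G` and preserving
`E(u)`. -/
theorem exists_commute_mulVec_eq (hG : ∀ A ∈ G, ∀ B ∈ G, A * B = B * A) {w : Fin n → ℂ}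
    (hw : w ∈ orbitSpan G u) :
    ∃ a : Matrix (Fin n) (Fin n) ℂ, (∀ A ∈ G, Commute a (A : Matrix (Fin n) (Fin n) ℂ)) ∧
      (∀ v ∈ orbitSpan G u, a *ᵥ v ∈ orbitSpan G u) ∧ a *ᵥ u = w := by
  induction hw using Submodule.span_induction with
  | mem x hx =>
    obtain ⟨A, hA, rfl⟩ := hx
    exact ⟨A, fun B hB => congrArg Units.val (hG A hA B hB),
      fun v hv => mulVec_mem_orbitSpan hA hv, rfl⟩
  | zero => exact ⟨0, fun A _ => Commute.zero_left _, fun v _ => by simp, by simp⟩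
  | add x y _ _ hx hy =>
    obtain ⟨a, ha, ha', rfl⟩ := hx
    obtain ⟨b, hb, hb', rfl⟩ := hy
    refine ⟨a + b, fun A hA => (ha A hA).add_left (hb A hA), fun v hv => ?_, add_mulVec a b u⟩
    rw [add_mulVec]
    exact add_mem (ha' v hv) (hb' v hv)
  | smul c x _ hx =>
    obtain ⟨a, ha, ha', rfl⟩ := hx
    refine ⟨c • a, fun A hA => (ha A hA).smul_left c, fun v hv => ?_, smul_mulVec c a u⟩
    rw [smul_mulVec]
    exact Submodule.smul_mem _ c (ha' v hv)

theorem mulVec_mem_closure_linOrbit {A : GL (Fin n) ℂ} (hA : A ∈ G) {v : Fin n → ℂ}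
    (hv : v ∈ closure (linOrbit G u)) :
    (A : Matrix (Fin n) (Fin n) ℂ) *ᵥ v ∈ closure (linOrbit G u) := by
  refine map_mem_closure (continuous_const.matrix_mulVec continuous_id) hv ?_
  rintro _ ⟨B, hB, rfl⟩
  exact ⟨A * B, G.mul_mem hA hB, by simp [Matrix.mulVec_mulVec]⟩

/-- A matrix commuting with `G` that sends `u` into the orbit closure preserves the orbit
closure. -/
theorem mulVec_mem_closure_linOrbit_of_commute {b : Matrix (Fin n) (Fin n) ℂ}
    (hb : ∀ A ∈ G, Commute b (A : Matrix (Fin n) (Fin n) ℂ))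
    (hbu : b *ᵥ u ∈ closure (linOrbit G u)) {v : Fin n → ℂ} (hv : v ∈ closure (linOrbit G u)) :
    b *ᵥ v ∈ closure (linOrbit G u) := by
  rw [← closure_closure]
  refine map_mem_closure (continuous_const.matrix_mulVec continuous_id) hv ?_
  rintro _ ⟨A, hA, rfl⟩
  rw [mulVec_mulVec, (hb A hA).eq, ← mulVec_mulVec]
  exact mulVec_mem_closure_linOrbit hA hbu

/-- The determinant is a polynomial in `z` with value `1` at `0`. -/
theorem finite_setOf_det_one_add_smul_eq_zero (N : Matrix (Fin n) (Fin n) ℂ) :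
    {z : ℂ | (1 + z • N).det = 0}.Finite := by
  let p : Polynomial ℂ :=
    ((1 : Matrix (Fin n) (Fin n) (Polynomial ℂ)) + (Polynomial.X : Polynomial ℂ) •
      N.map Polynomial.C).det
  have hp : ∀ z : ℂ, p.eval z = (1 + z • N).det := fun z => by
    rw [← Polynomial.coe_evalRingHom, RingHom.map_det]
    congr 1
    ext i j
    by_cases hij : i = j <;> simp [hij, mul_comm z]
  have hp0 : p ≠ 0 := fun h => by
    have h0 := hp 0
    simp [h] at h0
  exact (Polynomial.finite_setOfPred_isRoot hp0).subset fun z hz => (hp z).trans hz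

open Topology in
/-- If the closure of an orbit of an abelian linear group is a neighbourhood of the base point in
the span of the orbit, then the orbit is dense in its span. -/
theorem closure_linOrbit_eq_orbitSpan_of_mem_nhdsWithin
    (hG : ∀ A ∈ G, ∀ B ∈ G, A * B = B * A)
    (hu : closure (linOrbit G u) ∈ 𝓝[(orbitSpan G u : Set (Fin n → ℂ))] u) :
    closure (linOrbit G u) = orbitSpan G u := by
  refine closure_linOrbit_subset_orbitSpan.antisymm fun w hw => ?_
  obtain ⟨a, haG, haE, rfl⟩ := exists_commute_mulVec_eq hG hw
  let p : ℂ → Matrix (Fin n) (Fin n) ℂ := fun z => 1 + z • (a - 1)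
  have hpc : Continuous p := by fun_prop
  have hpG : ∀ z, ∀ A ∈ G, Commute (p z) (A : Matrix (Fin n) (Fin n) ℂ) := fun z A hA =>
    (Commute.one_left _).add_left (((haG A hA).sub_left (Commute.one_left _)).smul_left z)
  have hpE : ∀ z, ∀ v ∈ orbitSpan G u, p z *ᵥ v ∈ orbitSpan G u := fun z v hv => by
    simp only [p, add_mulVec, smul_mulVec, sub_mulVec, one_mulVec]
    exact add_mem hv (Submodule.smul_mem _ z (sub_mem (haE v hv) hv))
  let D : Set ℂ := {z | (p z).det = 0}ᶜ
  let T : Set ℂ := {z | p z *ᵥ u ∈ closure (linOrbit G u)}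
  have hfin : {z | (p z).det = 0}.Finite := finite_setOf_det_one_add_smul_eq_zero (a - 1)
  have hT : IsClosed T :=
    isClosed_closure.preimage (hpc.matrix_mulVec continuous_const)
  -- An injective endomorphism of the finite-dimensional `E(u)` is onto.
  have hinv : ∀ b ∈ D, ∀ v ∈ orbitSpan G u, (p b)⁻¹ *ᵥ v ∈ orbitSpan G u := by
    intro b hb v hv
    have hdet : IsUnit (p b).det := isUnit_iff_ne_zero.2 hb
    let g : orbitSpan G u →ₗ[ℂ] orbitSpan G u := (p b).mulVecLin.restrict (hpE b)
    have hg : Function.Injective g := fun x y hxy => by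
      have h : p b *ᵥ (x : Fin n → ℂ) = p b *ᵥ (y : Fin n → ℂ) := congrArg Subtype.val hxy
      exact Subtype.ext (mulVec_injective_of_isUnit ((isUnit_iff_isUnit_det _).2 hdet) h)
    obtain ⟨x, hx⟩ := LinearMap.injective_iff_surjective.1 hg ⟨v, hv⟩
    have hx' : p b *ᵥ (x : Fin n → ℂ) = v := congrArg Subtype.val hx
    rw [← hx', mulVec_mulVec, nonsing_inv_mul _ hdet, one_mulVec]
    exact x.2
  -- For `z` near `b`, `(p b)⁻¹ (p z) u` is close to `u` within `E(u)`, hence in the closure, which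
  -- `p b` preserves.
  have hopen : ∀ b ∈ D ∩ T, T ∈ 𝓝 b := by
    rintro b ⟨hb, hbT⟩
    have hdet : IsUnit (p b).det := isUnit_iff_ne_zero.2 hb
    have hq : Continuous fun z => (p b)⁻¹ *ᵥ (p z *ᵥ u) :=
      continuous_const.matrix_mulVec (hpc.matrix_mulVec continuous_const)
    have hqb : (p b)⁻¹ *ᵥ (p b *ᵥ u) = u := by
      rw [mulVec_mulVec, nonsing_inv_mul _ hdet, one_mulVec]
    have hqt : Filter.Tendsto (fun z => (p b)⁻¹ *ᵥ (p z *ᵥ u)) (𝓝 b)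
        (𝓝[(orbitSpan G u : Set (Fin n → ℂ))] u) := by
      refine tendsto_nhdsWithin_iff.2 ⟨?_, Filter.Eventually.of_forall fun z =>
        hinv b hb _ (hpE z u (Submodule.subset_span self_mem_linOrbit))⟩
      simpa only [hqb] using hq.tendsto b
    filter_upwards [hqt hu] with z hz
    have h := mulVec_mem_closure_linOrbit_of_commute (hpG b) hbT hz
    rwa [mulVec_mulVec, mul_nonsing_inv _ hdet, one_mulVec] at h
  have hD : IsPreconnected D :=
    (hfin.countable.isPathConnected_compl_of_one_lt_rank (by simp)).isConnected.isPreconnected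
  have h0T : (0 : ℂ) ∈ T := by simpa [T, p] using subset_closure self_mem_linOrbit
  have h0D : (0 : ℂ) ∈ D := by simp [D, p]
  have hDT : D ⊆ T := by
    by_contra hnot
    obtain ⟨z, hzD, hzT⟩ := Set.not_subset.1 hnot
    obtain ⟨y, hyD, hyT, hyT'⟩ := hD (interior T) Tᶜ isOpen_interior hT.isOpen_compl
      (fun b hb => by
        by_cases hbT : b ∈ T
        · exact Or.inl (mem_interior_iff_mem_nhds.2 (hopen b ⟨hb, hbT⟩))
        · exact Or.inr hbT)
      ⟨0, h0D, mem_interior_iff_mem_nhds.2 (hopen 0 ⟨h0D, h0T⟩)⟩ ⟨z, hzD, hzT⟩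
    exact hyT' (interior_subset hyT)
  have hdense : Dense D := hfin.countable.dense_compl ℂ
  -- `p 1 = a` may be singular, so `1` is reached only as a limit of points of `D`.
  have h1 : (1 : ℂ) ∈ T := closure_minimal hDT hT (hdense 1)
  simpa [T, p] using h1

end

/-- A linear subspace is an embedded submanifold. -/
theorem Submodule.isEmbeddedSubmanifold {F : Type*} [NormedAddCommGroup F] [NormedSpace ℝ F]
    (k : WithTop ℕ∞) (E : Submodule ℝ F) [Module.Finite ℝ E] :
    IsEmbeddedSubmanifold k (Module.finrank ℝ E) (E : Set F) := fun _ _ =>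
  ⟨OpenPartialHomeomorph.refl F, E, Set.mem_univ _, contDiff_id.contDiffOn, contDiff_id.contDiffOn,
    inferInstance, rfl, fun _ _ => Iff.rfl⟩

theorem theoremT (k : WithTop ℕ∞) (hk : 1 ≤ k) {n : ℕ} (G : Subgroup (GL (Fin n) ℂ))
    (hG : ∀ A ∈ G, ∀ B ∈ G, A * B = B * A) (u : Fin n → ℂ) :
    (∃ W : Submodule ℂ (Fin n → ℂ), (W : Set (Fin n → ℂ)) = closure (linOrbit G u)) ↔
      IsRegularOfOrder k (2 * orbitRank G u) (linOrbit G u) := by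
  constructor
  · rintro ⟨W, hW⟩ v -
    have hE : closure (linOrbit G u) = orbitSpan G u := by
      refine closure_linOrbit_subset_orbitSpan.antisymm ?_
      rw [← hW]
      exact Submodule.span_le.2 (hW ▸ subset_closure)
    refine ⟨Set.univ, isOpen_univ, Set.mem_univ v, ?_⟩
    rw [Set.inter_univ, hE, ← finrank_real_orbitSpan]
    exact ((orbitSpan G u).restrictScalars ℝ).isEmbeddedSubmanifold k
  · intro h
    obtain ⟨O, -, huO, hS⟩ := h u self_mem_linOrbit
    refine ⟨orbitSpan G u, (closure_linOrbit_eq_orbitSpan_of_mem_nhdsWithin hG ?_).symm⟩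
    refine Filter.mem_of_superset (hS.mem_nhdsWithin_of_subset hk
      (E := (orbitSpan G u).restrictScalars ℝ)
      (Set.inter_subset_left.trans closure_linOrbit_subset_orbitSpan) finrank_real_orbitSpan
      ⟨subset_closure self_mem_linOrbit, huO⟩) Set.inter_subset_left
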